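/- Let $h_1,\dots,h_d$ be linear forms on $\mathbb{R}^d$ whose coefficient matrix has determinant $1$, let $h_1^*,\dots,h_d^*$ be the dual forms, i.e. $\langle h_i,h_j^*\rangle=\delta_{ij}$ for the coefficient vectors, and let $\eta_1,\dots,\eta_d>0$. For the $\mathbf 0$-symmetric parallelepiped $\Pi=\{z\in\mathbb{R}^d : |h_i(z)|\le\eta_i,\ i=1,\dots,d\}$ (every $\mathbf 0$-symmetric parallelepiped has this form) let $\Pi^*=\{z\in\mathbb{R}^d : |h_i^*(z)|\le\frac1{\eta_i}\prod_{j=1}^d\eta_j,\ i=1,\dots,d\}$ be its pseudo-compound parallelepiped, and let $\mu_k(\Pi,\mathbb{Z}^d)$ be the $k$-th successive minimum, i.e. the smallest $\mu>0$ such that $\mu\Pi$ contains $k$ linearly independent points of $\mathbb{Z}^d$. Theorem. Let $\Pi$ be an arbitrary $\mathbf 0$-symmetric parallelepiped in $\mathbb{R}^3$ with $\mu_1(\Pi^*,\mathbb{Z}^3)\le1$ and $\mu_1(\Pi,\mathbb{Z}^3)>1$. Then $$\mu_1(\Pi,\mathbb{Z}^3)\le\frac{2}{\sqrt3}\quad\text{and}\quad\mu_2(\Pi,\mathbb{Z}^3)\le\frac54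 .$$ Moreover, the constants $2/\sqrt3$ and $5/4$ are exact: neither of them can be replaced by a smaller one. More precisely, there is a $\Pi$ with $\mu_1(\Pi^*,\mathbb{Z}^3)=1$ and $\mu_1(\Pi,\mathbb{Z}^3)=2/\sqrt3$; and there is a $\Pi$ in the limiting case $\mu_1(\Pi^*,\mathbb{Z}^3)=\mu_1(\Pi,\mathbb{Z}^3)=1$ with $\mu_2(\Pi,\mathbb{Z}^3)=5/4$, while $5/4$ is the least upper bound of $\mu_2(\Pi,\mathbb{Z}^3)$ over all $\Pi$ satisfying the hypotheses above (including the strict inequality $\mu_1(\Pi,\mathbb{Z}^3)>1$). -/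

import Mathlib

open scoped Pointwise

noncomputable section

/-- The integer lattice `ℤ^d` inside `ℝ^d`. -/
def integerLattice (d : ℕ) : AddSubgroup (Fin d → ℝ) :=
  ((Int.castAddHom ℝ).compLeft (Fin d)).range

/-- The `k`-th successive minimum of `M` with respect to the lattice `L`: the smallest `μ > 0`
such that `μ M` contains `k` linearly independent points of `L`. -/
def successiveMinimum {d : ℕ} (k : ℕ) (M : Set (Fin d → ℝ)) (L : AddSubgroup (Fin d → ℝ)) : ℝ :=
  sInf {μ : ℝ | 0 < μ ∧
    ∃ v : Fin k → (Fin d → ℝ), LinearIndependent ℝ v ∧ ∀ i, v i ∈ L ∧ v i ∈ μ • M}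

/-- A parallelepiped in `ℝ^d` symmetric about the origin, given by `d` linear forms with
coefficient matrix `H` (one form in each row), `det H = 1`, and by positive numbers `η i`. -/
structure SymmParallelepiped (d : ℕ) where
  /-- the matrix of the linear forms -/
  H : Matrix (Fin d) (Fin d) ℝ
  /-- the bounds for the linear forms -/
  η : Fin d → ℝ
  det_eq_one : H.det = 1
  η_pos : ∀ i, 0 < η i

namespace SymmParallelepiped

variable {d : ℕ}

/-- The set of points `z` with `|h_i(z)| ≤ η_i` for all `i`. -/
def toSet (P : SymmParallelepiped d) : Set (Fin d → ℝ) :=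
  {z | ∀ i, |(P.H.mulVec z) i| ≤ P.η i}

/-- The pseudo-compound parallelepiped: the points `z` with `|h_i^*(z)| ≤ (1 / η_i) ∏ η_j`, where
the rows `h_i^*` of `(H⁻¹)ᵀ` are the dual forms of the rows of `H`. -/
def pseudoCompound (P : SymmParallelepiped d) : SymmParallelepiped d where
  H := P.H⁻¹.transpose
  η := fun i => 1 / P.η i * ∏ j, P.η j
  det_eq_one := by
    rw [Matrix.det_transpose, Matrix.det_nonsing_inv, P.det_eq_one, Ring.inverse_one]
  η_pos := fun i =>
    mul_pos (one_div_pos.mpr (P.η_pos i)) (Finset.prod_pos fun j _ => P.η_pos j)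

/-- The forms of `P` and of `P.pseudoCompound` are dual: `⟨h_i, h_j^*⟩ = δ_ij`. -/
theorem dotProduct_pseudoCompound (P : SymmParallelepiped d) (i j : Fin d) :
    P.H i ⬝ᵥ P.pseudoCompound.H j = if i = j then 1 else 0 := by
  have h : P.H * P.H⁻¹ = 1 :=
    Matrix.mul_nonsing_inv _ (by rw [P.det_eq_one]; exact isUnit_one)
  have h2 := congrFun (congrFun h i) j
  rw [Matrix.one_apply, Matrix.mul_apply] at h2
  exact h2

/-- The `k`-th successive minimum of the parallelepiped with respect to `ℤ^d`. -/
def mu (k : ℕ) (P : SymmParallelepiped d) : ℝ :=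
  successiveMinimum k P.toSet (integerLattice d)

end SymmParallelepiped

end

/-!
Dividing the `i`-th form by `η i` turns the parallelepiped into the cube `[-1, 1]^3` and `ℤ^3` into
another lattice, whose basis is the matrix `SymmParallelepiped.normalized`; the normalized matrix
of the pseudo-compound is then the cofactor matrix. A nonzero integer point `w` of the
pseudo-compound can be written as a cross product `u ⨯₃ v` of integer vectors, so the hypothesis
says that the lattice contains a planar sublattice, spanned by the images of `u` and `v`, whose
area is at most `1` in each of the three coordinate projections. Projecting along the largest
coordinate of the normal vector, one finds that the section of the cube by this plane contains the
hexagon `|x|, |y|, |x + y| ≤ 1` (up to the sign of `y`), and the problem becomes one about planar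
lattices of determinant at most `1` and this hexagon.

Let `u` have hexagonal norm `s`. The lattice points `v + n u` lie on a line parallel to `u`, and
this line meets the hexagon of radius `r` in a chord at least as long as `u` as soon as
`r ≥ s / 4 + 1 / s` and `2 r ≥ s + 1 / s` (`exists_int_hexNorm_le`). If `s > 2 / √3`, this produces
a vector shorter than `u` by a definite factor, so vectors of norm arbitrarily close to `2 / √3`
or smaller exist; if `1 < s ≤ 5 / 4`, it produces a second vector of norm at most `5 / 4`. Both
statements are `SymmParallelepiped.exists_short_pair`. They are proved for an area bound `D`
slightly larger than `1`, so that it need not be known that the minimum of the pseudo-compound is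
attained.

Equality in the chord estimate occurs for `u = (s, -s / 2)`, where the lattice has minima `s` and
`s / 4 + 1 / s`. Adding a third, distant basis vector gives the parallelepipeds of
`exists_extremal`, for `1 ≤ s ≤ 2 / √3`: the end `s = 2 / √3` is extremal for the first minimum,
the end `s = 1` for the second, and `s ↓ 1` shows that `5 / 4` is the supremum under the strict
hypothesis.
-/

/-! ### Successive minima in normalized coordinates -/

section

open scoped Matrix

/-- An integer vector regarded as a real one. -/
def intVec {d : ℕ} (z : Fin d → ℤ) : Fin d → ℝ := fun i => (z i : ℝ)

theorem intVec_ne_zero {d : ℕ} {z : Fin d → ℤ} (hz : z ≠ 0) : intVec z ≠ 0 := by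
  intro h
  exact hz (funext fun i => Int.cast_eq_zero.mp (congrFun h i))

theorem intVec_crossProduct (u v : Fin 3 → ℤ) : intVec (u ⨯₃ v) = intVec u ⨯₃ intVec v := by
  ext i
  fin_cases i <;> simp [intVec, cross_apply]

/-- Vectors with nonzero cross product are linearly independent. -/
theorem linearIndependent_intVec_pair {u v : Fin 3 → ℤ} (h : u ⨯₃ v ≠ 0) :
    LinearIndependent ℝ fun i => intVec (![u, v] i) := by
  have h1 : intVec u ⨯₃ intVec v ≠ 0 := by
    rw [← intVec_crossProduct]
    exact intVec_ne_zero h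
  have h2 : (fun i => intVec (![u, v] i)) = ![intVec u, intVec v] := by
    ext i : 1
    fin_cases i <;> rfl
  rw [h2]
  exact crossProduct_ne_zero_iff_linearIndependent.mp h1

namespace SymmParallelepiped

variable {d : ℕ}

/-- The matrix of the forms `h_i / η_i`: it carries the parallelepiped onto the cube
`[-1, 1]^d`. -/
noncomputable def normalized (P : SymmParallelepiped d) : Matrix (Fin d) (Fin d) ℝ :=
  Matrix.of fun i j => P.H i j / P.η i

theorem normalized_mulVec (P : SymmParallelepiped d) (z : Fin d → ℝ) (i : Fin d) :
    (P.normalized *ᵥ z) i = (P.H *ᵥ z) i / P.η i := by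
  simp only [normalized, Matrix.mulVec, dotProduct, Matrix.of_apply, Finset.sum_div]
  exact Finset.sum_congr rfl fun j _ => by ring

theorem mem_smul_toSet_iff (P : SymmParallelepiped d) {μ : ℝ} (hμ : 0 < μ) (z : Fin d → ℝ) :
    z ∈ μ • P.toSet ↔ ∀ i, |(P.normalized *ᵥ z) i| ≤ μ := by
  rw [Set.mem_smul_set_iff_inv_smul_mem₀ hμ.ne']
  refine forall_congr' fun i => ?_
  rw [normalized_mulVec, Matrix.mulVec_smul, Pi.smul_apply, smul_eq_mul, abs_mul, abs_inv,
    abs_of_pos hμ, abs_div, abs_of_pos (P.η_pos i), inv_mul_le_iff₀ hμ, div_le_iff₀ (P.η_pos i)]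

theorem normalized_eq_diagonal_mul (P : SymmParallelepiped d) :
    P.normalized = Matrix.diagonal (fun i => (P.η i)⁻¹) * P.H := by
  ext i j
  rw [Matrix.diagonal_mul, normalized, Matrix.of_apply, div_eq_inv_mul]

theorem det_normalized (P : SymmParallelepiped d) : P.normalized.det = ∏ i, (P.η i)⁻¹ := by
  rw [normalized_eq_diagonal_mul, Matrix.det_mul, Matrix.det_diagonal, P.det_eq_one, mul_one]

theorem det_normalized_ne_zero (P : SymmParallelepiped d) : P.normalized.det ≠ 0 := by
  rw [det_normalized]
  exact Finset.prod_ne_zero_iff.mpr fun i _ => inv_ne_zero (P.η_pos i).ne'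

/-- Passing to the pseudo-compound replaces the normalized matrix by its cofactor matrix. -/
theorem normalized_pseudoCompound (P : SymmParallelepiped 3) :
    P.pseudoCompound.normalized = P.normalized.adjugateᵀ := by
  have h0 := (P.η_pos 0).ne'
  have h1 := (P.η_pos 1).ne'
  have h2 := (P.η_pos 2).ne'
  have hinv : P.H⁻¹ = P.H.adjugate := by
    rw [Matrix.inv_def, P.det_eq_one, Ring.inverse_one, one_smul]
  ext i j
  simp only [normalized, pseudoCompound, hinv, Matrix.adjugate_fin_three, Matrix.of_apply,
    Matrix.transpose_apply, Fin.prod_univ_three]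
  fin_cases i <;> fin_cases j <;> simp <;> field_simp

/-- Every matrix of positive determinant is the normalized matrix of a parallelepiped. -/
theorem exists_normalized_eq (A : Matrix (Fin 3) (Fin 3) ℝ) (hA : 0 < A.det) :
    ∃ P : SymmParallelepiped 3, P.normalized = A := by
  obtain ⟨η, hη, hprod⟩ : ∃ η : Fin 3 → ℝ, (∀ i, 0 < η i) ∧ ∏ i, η i = A.det⁻¹ := by
    refine ⟨![A.det⁻¹, 1, 1], fun i => ?_, by simp [Fin.prod_univ_three]⟩
    fin_cases i <;> simp [hA]
  refine ⟨⟨Matrix.diagonal η * A, η, ?_, hη⟩, ?_⟩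
  · rw [Matrix.det_mul, Matrix.det_diagonal, hprod, inv_mul_cancel₀ hA.ne']
  · ext i j
    simp only [normalized, Matrix.of_apply, Matrix.diagonal_mul]
    exact mul_div_cancel_left₀ _ (hη i).ne'

/-- The successive minima in terms of integer vectors and normalized coordinates. -/
theorem mu_eq (k : ℕ) (P : SymmParallelepiped d) :
    P.mu k = sInf {μ : ℝ | 0 < μ ∧ ∃ z : Fin k → Fin d → ℤ,
      LinearIndependent ℝ (fun i => intVec (z i)) ∧
        ∀ i j, |(P.normalized *ᵥ intVec (z i)) j| ≤ μ} := by
  rw [mu, successiveMinimum]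
  congr 1
  ext μ
  refine and_congr_right fun hμ => ?_
  constructor
  · rintro ⟨v, hv, h⟩
    choose z hz using fun i => (h i).1
    obtain rfl : (fun i => intVec (z i)) = v := funext hz
    exact ⟨z, hv, fun i => (P.mem_smul_toSet_iff hμ _).mp (h i).2⟩
  · rintro ⟨z, hv, h⟩
    exact ⟨fun i => intVec (z i), hv,
      fun i => ⟨⟨z i, rfl⟩, (P.mem_smul_toSet_iff hμ _).mpr (h i)⟩⟩

theorem mu_one_le (P : SymmParallelepiped d) {μ : ℝ} (hμ : 0 < μ) {z : Fin d → ℤ} (hz : z ≠ 0)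
    (h : ∀ j, |(P.normalized *ᵥ intVec z) j| ≤ μ) : P.mu 1 ≤ μ := by
  rw [mu_eq]
  refine csInf_le ⟨0, fun x hx => hx.1.le⟩ ⟨hμ, fun _ => z, ?_, fun _ => h⟩
  exact LinearIndependent.of_subsingleton (0 : Fin 1) (intVec_ne_zero hz)

theorem mu_two_le (P : SymmParallelepiped 3) {μ : ℝ} (hμ : 0 < μ) {u v : Fin 3 → ℤ}
    (huv : u ⨯₃ v ≠ 0) (hu : ∀ j, |(P.normalized *ᵥ intVec u) j| ≤ μ)
    (hv : ∀ j, |(P.normalized *ᵥ intVec v) j| ≤ μ) : P.mu 2 ≤ μ := by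
  rw [mu_eq]
  refine csInf_le ⟨0, fun x hx => hx.1.le⟩
    ⟨hμ, ![u, v], linearIndependent_intVec_pair huv, fun i => ?_⟩
  fin_cases i
  · exact hu
  · exact hv

/-- Every integer point lies in some dilate, so the set defining the first minimum is nonempty. -/
theorem exists_bound (P : SymmParallelepiped d) (z : Fin d → ℤ) :
    ∃ μ : ℝ, 0 < μ ∧ ∀ j, |(P.normalized *ᵥ intVec z) j| ≤ μ := by
  refine ⟨1 + ∑ j, |(P.normalized *ᵥ intVec z) j|,
    add_pos_of_pos_of_nonneg one_pos (Finset.sum_nonneg fun j _ => abs_nonneg _), fun j => ?_⟩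
  have := Finset.single_le_sum (f := fun j => |(P.normalized *ᵥ intVec z) j|)
    (fun j _ => abs_nonneg _) (Finset.mem_univ j)
  linarith

theorem exists_of_mu_one_lt (P : SymmParallelepiped 3) {D : ℝ} (h : P.mu 1 < D) :
    ∃ z : Fin 3 → ℤ, z ≠ 0 ∧ ∀ j, |(P.normalized *ᵥ intVec z) j| ≤ D := by
  rw [mu_eq] at h
  -- an empty set would have infimum `0` by convention, so nonemptiness matters here
  obtain ⟨μ, hμ, hb⟩ := P.exists_bound (fun _ => 1)
  obtain ⟨ν, ⟨-, z, hz, hzν⟩, hν⟩ := exists_lt_of_csInf_lt (by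
    exact ⟨μ, hμ, fun _ _ => 1, LinearIndependent.of_subsingleton (0 : Fin 1)
      (intVec_ne_zero fun h => one_ne_zero (congrFun h 0)), fun _ => hb⟩) h
  refine ⟨z 0, fun h0 => hz.ne_zero 0 ?_, fun j => (hzν 0 j).trans hν.le⟩
  ext i
  simp [h0, intVec]

/-- The first minimum equals `m` when `m` is attained and is a lower bound. -/
theorem mu_one_eq (P : SymmParallelepiped d) {m : ℝ} (hm : 0 < m) {z : Fin d → ℤ} (hz : z ≠ 0)
    (h : ∀ j, |(P.normalized *ᵥ intVec z) j| ≤ m)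
    (hlow : ∀ w : Fin d → ℤ, w ≠ 0 → ∀ μ : ℝ,
      (∀ j, |(P.normalized *ᵥ intVec w) j| ≤ μ) → m ≤ μ) : P.mu 1 = m := by
  refine le_antisymm (P.mu_one_le hm hz h) ?_
  rw [mu_eq]
  refine le_csInf ⟨m, hm, fun _ => z, LinearIndependent.of_subsingleton (0 : Fin 1)
    (intVec_ne_zero hz), fun _ => h⟩ ?_
  rintro μ ⟨-, v, hv, hμ⟩
  refine hlow (v 0) (fun h0 => hv.ne_zero 0 ?_) μ (hμ 0)
  ext i
  simp [h0, intVec]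

/-- The second minimum equals `m` when `m` is attained and no two independent integer vectors
do better. -/
theorem mu_two_eq (P : SymmParallelepiped 3) {m : ℝ} (hm : 0 < m) {u v : Fin 3 → ℤ}
    (huv : u ⨯₃ v ≠ 0) (hu : ∀ j, |(P.normalized *ᵥ intVec u) j| ≤ m)
    (hv : ∀ j, |(P.normalized *ᵥ intVec v) j| ≤ m)
    (hlow : ∀ u v : Fin 3 → ℤ, u ⨯₃ v ≠ 0 → ∀ μ : ℝ,
      (∀ j, |(P.normalized *ᵥ intVec u) j| ≤ μ) →
      (∀ j, |(P.normalized *ᵥ intVec v) j| ≤ μ) → m ≤ μ) : P.mu 2 = m := by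
  refine le_antisymm (P.mu_two_le hm huv hu hv) ?_
  rw [mu_eq]
  refine le_csInf ⟨m, hm, ![u, v], linearIndependent_intVec_pair huv, fun i => ?_⟩ ?_
  · fin_cases i
    · exact hu
    · exact hv
  · rintro μ ⟨-, z, hz, hμ⟩
    refine hlow (z 0) (z 1) (fun h0 => ?_) μ (hμ 0) (hμ 1)
    have h1 : intVec (z 0) ⨯₃ intVec (z 1) ≠ 0 := by
      refine crossProduct_ne_zero_iff_linearIndependent.mpr ?_
      have h2 : (fun i => intVec (z i)) = ![intVec (z 0), intVec (z 1)] := by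
        ext i : 1
        fin_cases i <;> rfl
      rwa [← h2]
    apply h1
    rw [← intVec_crossProduct, h0]
    ext i
    simp [intVec]

end SymmParallelepiped

end

/-! ### Chords of the hexagon -/

/-- The norm on the plane whose unit ball is the hexagon `|x|, |y|, |x + y| ≤ 1`. -/
def hexNorm (x y : ℝ) : ℝ := max |x| (max |y| |x + y|)

theorem hexNorm_le_iff {x y r : ℝ} : hexNorm x y ≤ r ↔ |x| ≤ r ∧ |y| ≤ r ∧ |x + y| ≤ r := by
  simp [hexNorm]

theorem hexNorm_swap (x y : ℝ) : hexNorm y x = hexNorm x y := by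
  rw [hexNorm, hexNorm, add_comm y x, max_left_comm]

theorem hexNorm_shear (x y : ℝ) : hexNorm (x + y) (-y) = hexNorm x y := by
  rw [hexNorm, hexNorm, abs_neg, add_neg_cancel_right, max_comm |y|, max_left_comm,
    max_comm |x + y|, max_left_comm]

theorem hexNorm_neg (x y : ℝ) : hexNorm (-x) (-y) = hexNorm x y := by
  rw [hexNorm, hexNorm, abs_neg, abs_neg, ← neg_add, abs_neg]

/-- A chord of the hexagon of radius `r` in the direction `(s, -t)` has length at least that of
`(s, -t)`, so it contains a point of every translate of `ℤ (s, -t)` on its line. -/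
theorem exists_int_chord {s t x y r D : ℝ} (hs : 0 < s) (ht : 0 ≤ t) (hts : t ≤ s)
    (hd : 0 ≤ s * y + t * x) (hD : s * y + t * x ≤ D) (h1 : s ^ 2 + 4 * D ≤ 4 * r * s)
    (h2 : s ^ 2 + D ≤ 2 * r * s) :
    ∃ n : ℤ, hexNorm (x + n * s) (y + n * -t) ≤ r := by
  set d := s * y + t * x with hd_def
  have hr : 0 < r := by
    by_contra! h
    nlinarith
  have hgap : 0 ≤ r * s - d := by nlinarith
  -- the chord is `-A ≤ X ≤ B`, cut out by `|X| ≤ r` and by the two edges on the side of `d ≥ 0`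
  obtain ⟨A, B, hA0, hB0, hA, hB, htA, htB, hAB⟩ : ∃ A B : ℝ, 0 ≤ A ∧ 0 ≤ B ∧ A ≤ r ∧ B ≤ r ∧
      t * A ≤ r * s - d ∧ (s - t) * B ≤ r * s - d ∧ s ≤ A + B := by
    have key1 : s * s ≤ 2 * r * s - d := by nlinarith
    have key2 : s ≤ 2 * r := by
      by_contra! h
      nlinarith
    have ht' : 0 ≤ s - t := by linarith
    by_cases ha : t * r ≤ r * s - d
    · by_cases hb : (s - t) * r ≤ r * s - d
      · exact ⟨r, r, hr.le, hr.le, le_rfl, le_rfl, ha, hb, by linarith⟩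
      · push Not at hb
        have hpos : 0 < s - t := by
          by_contra! h
          nlinarith
        refine ⟨r, (r * s - d) / (s - t), hr.le, by positivity, le_rfl, ?_, ha, ?_, ?_⟩
        · rw [div_le_iff₀ hpos]; linarith
        · rw [mul_div_cancel₀ _ hpos.ne']
        · rw [← sub_le_iff_le_add', le_div_iff₀ hpos]
          rcases le_total s r with h | h
          · nlinarith
          · nlinarith
    · push Not at ha
      have hpos : 0 < t := by
        by_contra! h
        nlinarith
      by_cases hb : (s - t) * r ≤ r * s - d
      · refine ⟨(r * s - d) / t, r, by positivity, hr.le, ?_, le_rfl, ?_, hb, ?_⟩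
        · rw [div_le_iff₀ hpos]; linarith
        · rw [mul_div_cancel₀ _ hpos.ne']
        · rw [← sub_le_iff_le_add, le_div_iff₀ hpos]
          rcases le_total s r with h | h
          · nlinarith
          · nlinarith
      · push Not at hb
        have hpos' : 0 < s - t := by
          by_contra! h
          nlinarith
        refine ⟨(r * s - d) / t, (r * s - d) / (s - t), by positivity, by positivity, ?_, ?_,
          ?_, ?_, ?_⟩
        · rw [div_le_iff₀ hpos]; linarith
        · rw [div_le_iff₀ hpos']; linarith
        · rw [mul_div_cancel₀ _ hpos.ne']
        · rw [mul_div_cancel₀ _ hpos'.ne']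
        · -- here `t (s - t) ≤ s² / 4` enters
          rw [div_add_div _ _ hpos.ne' hpos'.ne', le_div_iff₀ (mul_pos hpos hpos')]
          have h3 : s ^ 2 ≤ 4 * (r * s - d) := by linarith
          have h4 : 4 * (t * (s - t)) ≤ s ^ 2 := by nlinarith [sq_nonneg (s - 2 * t)]
          nlinarith
  refine ⟨⌊(B - x) / s⌋, ?_⟩
  have hn1 := (le_div_iff₀ hs).mp (Int.floor_le ((B - x) / s))
  have hn2 := (div_lt_iff₀ hs).mp (Int.lt_floor_add_one ((B - x) / s))
  set n : ℝ := (⌊(B - x) / s⌋ : ℝ)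
  have hX1 : x + n * s ≤ B := by linarith
  have hX2 : -A ≤ x + n * s := by linarith
  have ht' : 0 ≤ s - t := by linarith
  set X := x + n * s with hX
  have e1 : s * (y + n * -t) = d - t * X := by rw [hd_def, hX]; ring
  have e2 : s * (X + (y + n * -t)) = d + (s - t) * X := by rw [hd_def, hX]; ring
  have p1 : t * X ≤ t * B := mul_le_mul_of_nonneg_left hX1 ht
  have p2 : t * -A ≤ t * X := mul_le_mul_of_nonneg_left hX2 ht
  have p3 : (s - t) * X ≤ (s - t) * B := mul_le_mul_of_nonneg_left hX1 ht'
  have p4 : (s - t) * -A ≤ (s - t) * X := mul_le_mul_of_nonneg_left hX2 ht'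
  have p5 : t * B ≤ s * r := mul_le_mul hts hB hB0 hs.le
  have p6 : (s - t) * A ≤ s * r := mul_le_mul (by linarith) hA hA0 hs.le
  rw [hexNorm_le_iff]
  refine ⟨abs_le.mpr ⟨by linarith, by linarith⟩, abs_le.mpr ⟨?_, ?_⟩, abs_le.mpr ⟨?_, ?_⟩⟩ <;>
    refine le_of_mul_le_mul_left ?_ hs <;> linarith

theorem exists_int_hexNorm_le_of_first {u₁ u₂ v₁ v₂ s r D : ℝ} (hs : 0 < s) (hu : |u₁| = s)
    (hu2 : |u₂| ≤ s) (hu3 : |u₁ + u₂| ≤ s) (hD : |u₁ * v₂ - u₂ * v₁| ≤ D)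
    (h1 : s ^ 2 + 4 * D ≤ 4 * r * s) (h2 : s ^ 2 + D ≤ 2 * r * s) :
    ∃ n : ℤ, hexNorm (v₁ + n * u₁) (v₂ + n * u₂) ≤ r := by
  have hD' := abs_le.mp hD
  have hu2' := abs_le.mp hu2
  have hu3' := abs_le.mp hu3
  -- the signs of `u` and `v` are normalized to `u₁ = s` and `det (u, v) ≥ 0`
  rcases abs_choice u₁ with h | h <;> rw [h] at hu <;> rcases le_total 0 (u₁ * v₂ - u₂ * v₁) with
    hd | hd
  · obtain ⟨n, hn⟩ := exists_int_chord (t := -u₂) (x := v₁) (y := v₂) hs (by linarith)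
      (by linarith) (by rw [← hu]; linarith) (by rw [← hu]; linarith) h1 h2
    exact ⟨n, by rw [hu]; simpa using hn⟩
  · obtain ⟨n, hn⟩ := exists_int_chord (t := -u₂) (x := -v₁) (y := -v₂) hs (by linarith)
      (by linarith) (by rw [← hu]; linarith) (by rw [← hu]; linarith) h1 h2
    refine ⟨-n, ?_⟩
    rw [← hexNorm_neg]
    rw [← hu] at hn
    convert hn using 2 <;> push_cast <;> ring
  · obtain ⟨n, hn⟩ := exists_int_chord (t := u₂) (x := -v₁) (y := -v₂) hs (by linarith)
      (by linarith) (by rw [← hu]; linarith) (by rw [← hu]; linarith) h1 h2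
    refine ⟨n, ?_⟩
    rw [← hexNorm_neg]
    rw [← hu] at hn
    convert hn using 2 <;> ring
  · obtain ⟨n, hn⟩ := exists_int_chord (t := u₂) (x := v₁) (y := v₂) hs (by linarith)
      (by linarith) (by rw [← hu]; linarith) (by rw [← hu]; linarith) h1 h2
    refine ⟨-n, ?_⟩
    rw [← hu] at hn
    convert hn using 2 <;> push_cast <;> ring

/-- If `u` has hexagonal norm `s` and the parallelogram on `u`, `v` has area at most `D`, then some
`v + n u` lies in the hexagon of radius `r`, as soon as `r ≥ s / 4 + D / s` and
`2 r ≥ s + D / s`. -/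
theorem exists_int_hexNorm_le {u₁ u₂ v₁ v₂ s r D : ℝ} (hs : 0 < s) (hu : hexNorm u₁ u₂ = s)
    (hD : |u₁ * v₂ - u₂ * v₁| ≤ D)
    (h1 : s ^ 2 + 4 * D ≤ 4 * r * s) (h2 : s ^ 2 + D ≤ 2 * r * s) :
    ∃ n : ℤ, hexNorm (v₁ + n * u₁) (v₂ + n * u₂) ≤ r := by
  obtain ⟨b1, b2, b3⟩ := hexNorm_le_iff.mp hu.le
  have hc : |u₁| = s ∨ |u₂| = s ∨ |u₁ + u₂| = s := by
    rw [hexNorm] at hu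
    rcases max_choice |u₁| (max |u₂| |u₁ + u₂|) with h | h
    · exact Or.inl (h ▸ hu)
    · rw [h] at hu
      rcases max_choice |u₂| |u₁ + u₂| with h | h
      · exact Or.inr (Or.inl (h ▸ hu))
      · exact Or.inr (Or.inr (h ▸ hu))
  rcases hc with h | h | h
  · exact exists_int_hexNorm_le_of_first hs h b2 b3 hD h1 h2
  · obtain ⟨n, hn⟩ := exists_int_hexNorm_le_of_first (v₁ := v₂) (v₂ := v₁) hs h b1
      (by rwa [add_comm]) (by rwa [abs_sub_comm]) h1 h2
    exact ⟨n, by rwa [hexNorm_swap] at hn⟩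
  · obtain ⟨n, hn⟩ := exists_int_hexNorm_le_of_first (u₂ := -u₂) (v₁ := v₁ + v₂) (v₂ := -v₂) hs h
      (by rwa [abs_neg]) (by rwa [add_neg_cancel_right])
      (by rw [← abs_neg]; convert hD using 2; ring) h1 h2
    refine ⟨n, ?_⟩
    rw [← hexNorm_shear]
    convert hn using 2 <;> ring

/-! ### The planar lattice orthogonal to an integer vector -/

section

open scoped Matrix

/-- The plane section of a cube contains a hexagon: if `a` has its largest coordinate in the third
place, a point of the plane `a ⬝ x = 0` is controlled by the hexagonal norm of its first two
coordinates, up to the sign of the second one. -/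
theorem exists_sign_abs_le_hexNorm {a₁ a₂ a₃ : ℝ} (h3 : a₃ ≠ 0) (h1 : |a₁| ≤ |a₃|)
    (h2 : |a₂| ≤ |a₃|) : ∃ ε : ℝ, |ε| = 1 ∧ ∀ x₁ x₂ x₃ : ℝ, a₁ * x₁ + a₂ * x₂ + a₃ * x₃ = 0 →
      |x₁| ≤ hexNorm x₁ (ε * x₂) ∧ |x₂| ≤ hexNorm x₁ (ε * x₂) ∧ |x₃| ≤ hexNorm x₁ (ε * x₂) := by
  -- for coefficients of the same sign, split off the smaller one times `x + y`
  have key : ∀ b₁ b₂ x y : ℝ, 0 ≤ b₁ * b₂ → |b₁| ≤ |a₃| → |b₂| ≤ |a₃| →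
      |b₁ * x + b₂ * y| ≤ |a₃| * hexNorm x y := by
    intro b₁ b₂ x y hb hb1 hb2
    obtain ⟨p1, p2, p3⟩ := hexNorm_le_iff.mp (le_refl (hexNorm x y))
    have hN : 0 ≤ hexNorm x y := (abs_nonneg x).trans p1
    rcases le_total |b₁| |b₂| with h | h
    · have e : b₁ * x + b₂ * y = b₁ * (x + y) + (b₂ - b₁) * y := by ring
      have hb' : |b₁| + |b₂ - b₁| = |b₂| := by
        rcases mul_nonneg_iff.mp hb with ⟨q1, q2⟩ | ⟨q1, q2⟩
        · rw [abs_of_nonneg q1, abs_of_nonneg q2] at *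
          rw [abs_of_nonneg (by linarith)]; ring
        · rw [abs_of_nonpos q1, abs_of_nonpos q2] at *
          rw [abs_of_nonpos (by linarith)]; ring
      calc |b₁ * x + b₂ * y| ≤ |b₁| * |x + y| + |b₂ - b₁| * |y| := by
            rw [e, ← abs_mul, ← abs_mul]; exact abs_add_le _ _
        _ ≤ |b₁| * hexNorm x y + |b₂ - b₁| * hexNorm x y := by gcongr
        _ = |b₂| * hexNorm x y := by rw [← add_mul, hb']
        _ ≤ |a₃| * hexNorm x y := by gcongr
    · have e : b₁ * x + b₂ * y = b₂ * (x + y) + (b₁ - b₂) * x := by ring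
      have hb' : |b₂| + |b₁ - b₂| = |b₁| := by
        rcases mul_nonneg_iff.mp hb with ⟨q1, q2⟩ | ⟨q1, q2⟩
        · rw [abs_of_nonneg q1, abs_of_nonneg q2] at *
          rw [abs_of_nonneg (by linarith)]; ring
        · rw [abs_of_nonpos q1, abs_of_nonpos q2] at *
          rw [abs_of_nonpos (by linarith)]; ring
      calc |b₁ * x + b₂ * y| ≤ |b₂| * |x + y| + |b₁ - b₂| * |x| := by
            rw [e, ← abs_mul, ← abs_mul]; exact abs_add_le _ _
        _ ≤ |b₂| * hexNorm x y + |b₁ - b₂| * hexNorm x y := by gcongr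
        _ = |b₁| * hexNorm x y := by rw [← add_mul, hb']
        _ ≤ |a₃| * hexNorm x y := by gcongr
  obtain ⟨ε, hε, hsign⟩ : ∃ ε : ℝ, (ε = 1 ∨ ε = -1) ∧ 0 ≤ a₁ * (ε * a₂) := by
    rcases le_total 0 (a₁ * a₂) with h | h
    · exact ⟨1, Or.inl rfl, by linarith⟩
    · exact ⟨-1, Or.inr rfl, by linarith⟩
  have hε1 : |ε| = 1 := by rcases hε with rfl | rfl <;> simp
  have hε2 : ε * ε = 1 := by rcases hε with rfl | rfl <;> simp
  refine ⟨ε, hε1, fun x₁ x₂ x₃ hx => ?_⟩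
  obtain ⟨p1, p2, -⟩ := hexNorm_le_iff.mp (le_refl (hexNorm x₁ (ε * x₂)))
  rw [abs_mul, hε1, one_mul] at p2
  refine ⟨p1, p2, ?_⟩
  have h := key a₁ (ε * a₂) x₁ (ε * x₂) hsign h1 (by rwa [abs_mul, hε1, one_mul])
  have e : a₁ * x₁ + ε * a₂ * (ε * x₂) = -(a₃ * x₃) := by
    linear_combination hx + a₂ * x₂ * hε2
  rw [e, abs_neg, abs_mul] at h
  exact le_of_mul_le_mul_left h (abs_pos.mpr h3)

/-- Planar coordinates `f`, `g` on the plane orthogonal to `a`, in which the section of the cube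
contains the hexagon and areas are measured by a coordinate of the cross product. -/
theorem exists_planar_coordinates {a : Fin 3 → ℝ} (ha : a ≠ 0) {D : ℝ} (hD : ∀ i, |a i| ≤ D) :
    ∃ f g : (Fin 3 → ℝ) →ₗ[ℝ] ℝ,
      (∀ x, a ⬝ᵥ x = 0 → ∀ i, |x i| ≤ hexNorm (f x) (g x)) ∧
      ∀ x y, x ⨯₃ y = a → |f x * g y - g x * f y| ≤ D := by
  obtain ⟨k, hk⟩ : ∃ k, ∀ i, |a i| ≤ |a k| := by
    obtain ⟨k, -, hk⟩ := Finset.exists_max_image Finset.univ (fun i => |a i|)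
      Finset.univ_nonempty
    exact ⟨k, fun i => hk i (Finset.mem_univ i)⟩
  have hk0 : a k ≠ 0 := by
    intro h
    refine ha (funext fun i => ?_)
    have := hk i
    rw [h, abs_zero] at this
    exact abs_nonpos_iff.mp this
  obtain ⟨ε, hε, h⟩ := exists_sign_abs_le_hexNorm hk0 (hk (k + 1)) (hk (k + 2))
  refine ⟨LinearMap.proj (k + 1), ε • LinearMap.proj (k + 2), ?_, ?_⟩
  · intro x hx i
    rw [dotProduct, Fin.sum_univ_three] at hx
    have hx' : a (k + 1) * x (k + 1) + a (k + 2) * x (k + 2) + a k * x k = 0 := by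
      fin_cases k
      · simp; linarith
      · simp; linarith
      · simp; linarith
    obtain ⟨p1, p2, p3⟩ := h _ _ _ hx'
    have hi : i = k + 1 ∨ i = k + 2 ∨ i = k := by
      fin_cases k <;> fin_cases i <;> simp
    simp only [LinearMap.smul_apply, LinearMap.proj_apply, smul_eq_mul]
    rcases hi with rfl | rfl | rfl <;> assumption
  · intro x y hxy
    have e : a k = x (k + 1) * y (k + 2) - x (k + 2) * y (k + 1) := by
      rw [← hxy, cross_apply]
      fin_cases k <;> rfl
    simp only [LinearMap.smul_apply, LinearMap.proj_apply, smul_eq_mul]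
    calc |x (k + 1) * (ε * y (k + 2)) - ε * x (k + 2) * y (k + 1)| = |ε * a k| := by
          rw [e]; congr 1; ring
      _ = |a k| := by rw [abs_mul, hε, one_mul]
      _ ≤ D := hD k

/-- Every integer vector is a cross product of integer vectors. -/
theorem exists_crossProduct_eq (w : Fin 3 → ℤ) : ∃ u v : Fin 3 → ℤ, u ⨯₃ v = w := by
  by_cases h : Int.gcd (w 0) (w 1) = 0
  · rw [Int.gcd_eq_zero_iff] at h
    refine ⟨![1, 0, 0], ![0, w 2, 0], ?_⟩
    ext i
    fin_cases i <;> simp [cross_apply, h]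
  · obtain ⟨p, hp⟩ := Int.gcd_dvd_left (w 0) (w 1)
    obtain ⟨q, hq⟩ := Int.gcd_dvd_right (w 0) (w 1)
    have hb := Int.gcd_eq_gcd_ab (w 0) (w 1)
    set g : ℤ := (Int.gcd (w 0) (w 1) : ℤ)
    set α := Int.gcdA (w 0) (w 1)
    set β := Int.gcdB (w 0) (w 1)
    have hg : g ≠ 0 := by simpa [g] using h
    have hpq : p * α + q * β = 1 := by
      refine mul_left_cancel₀ hg ?_
      linear_combination -hb - α * hp - β * hq
    refine ⟨![q, -p, 0], ![w 2 * α, w 2 * β, -g], ?_⟩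
    ext i
    fin_cases i
    · simp [cross_apply]; linear_combination -hp
    · simp [cross_apply]; linear_combination -hq
    · simp [cross_apply]; linear_combination w 2 * hpq

/-- The cofactor matrix of `A` describes the action of `A` on cross products. -/
theorem adjugate_transpose_mulVec_crossProduct {R : Type*} [CommRing R]
    (A : Matrix (Fin 3) (Fin 3) R) (u v : Fin 3 → R) :
    A.adjugateᵀ *ᵥ (u ⨯₃ v) = (A *ᵥ u) ⨯₃ (A *ᵥ v) := by
  ext i
  simp only [Matrix.adjugate_fin_three, cross_apply, Matrix.mulVec, dotProduct,
    Fin.sum_univ_three, Matrix.transpose_apply, Matrix.of_apply]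
  fin_cases i <;> simp <;> ring

/-- A set of reals bounded below by a positive number is not closed under shrinking by a fixed
factor `q < 1`. -/
theorem eq_empty_of_contracting {T : Set ℝ} {m q : ℝ} (hm : 0 < m) (hq : 0 < q) (hq1 : q < 1)
    (hT : ∀ s ∈ T, m ≤ s) (h : ∀ s ∈ T, ∃ s' ∈ T, s' ≤ q * s) : T = ∅ := by
  by_contra hne
  have hne' : T.Nonempty := Set.nonempty_iff_ne_empty.mpr hne
  have hpos : 0 < sInf T := hm.trans_le (le_csInf hne' hT)
  have hlt : sInf T < sInf T / q := by
    rw [lt_div_iff₀ hq]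
    nlinarith
  obtain ⟨s, hs, hs'⟩ := exists_lt_of_csInf_lt hne' hlt
  obtain ⟨s', hs'T, hle⟩ := h s hs
  have h1 : sInf T ≤ s' := csInf_le ⟨m, hT⟩ hs'T
  rw [lt_div_iff₀ hq] at hs'
  linarith

/-- One reduction step on a pair of integer vectors with cross product `w`: a vector `u` of
hexagonal norm `s` can be exchanged for a vector of hexagonal norm at most `r`
without changing the cross product. -/
theorem exists_reduced_pair {A : Matrix (Fin 3) (Fin 3) ℝ} {f g : (Fin 3 → ℝ) →ₗ[ℝ] ℝ}
    {u v : Fin 3 → ℤ} {s r D : ℝ} (hs : 0 < s)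
    (hu : hexNorm (f (A *ᵥ intVec u)) (g (A *ᵥ intVec u)) = s)
    (hD : |f (A *ᵥ intVec u) * g (A *ᵥ intVec v) -
      g (A *ᵥ intVec u) * f (A *ᵥ intVec v)| ≤ D)
    (h1 : s ^ 2 + 4 * D ≤ 4 * r * s) (h2 : s ^ 2 + D ≤ 2 * r * s) :
    ∃ v' : Fin 3 → ℤ, v' ⨯₃ (-u) = u ⨯₃ v ∧
      hexNorm (f (A *ᵥ intVec v')) (g (A *ᵥ intVec v')) ≤ r := by
  obtain ⟨n, hn⟩ := exists_int_hexNorm_le hs hu hD h1 h2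
  refine ⟨v + n • u, ?_, ?_⟩
  · ext i
    fin_cases i <;> simp [cross_apply] <;> ring
  · have e : intVec (v + n • u) = intVec v + (n : ℝ) • intVec u := by
      ext i
      simp [intVec]
    simpa only [e, Matrix.mulVec_add, Matrix.mulVec_smul, map_add, map_smul, smul_eq_mul]
      using hn

namespace SymmParallelepiped

/-- The planar lattice of integer vectors orthogonal to `w` contains a vector of hexagonal norm
below `m` once `m² > 4 D / 3`; if moreover all its vectors are longer than `1` by the margin
`2 (D - 1)`, it contains two independent vectors in the cube of radius `5 / 4`. -/
theorem exists_short_pair (P : SymmParallelepiped 3) {w : Fin 3 → ℤ} (hw : w ≠ 0) {D : ℝ}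
    (hD : ∀ i, |(P.pseudoCompound.normalized *ᵥ intVec w) i| ≤ D) :
    (∀ m : ℝ, 0 < m → 4 * D < 3 * m ^ 2 →
      ∃ u : Fin 3 → ℤ, u ≠ 0 ∧ ∀ i, |(P.normalized *ᵥ intVec u) i| ≤ m) ∧
    (1 ≤ D → D ≤ 9 / 8 → (∀ u : Fin 3 → ℤ, u ≠ 0 → ∀ r : ℝ,
        (∀ i, |(P.normalized *ᵥ intVec u) i| ≤ r) → 1 + 2 * (D - 1) ≤ r) →
      ∃ u v : Fin 3 → ℤ, u ⨯₃ v ≠ 0 ∧ (∀ i, |(P.normalized *ᵥ intVec u) i| ≤ 5 / 4) ∧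
        ∀ i, |(P.normalized *ᵥ intVec v) i| ≤ 5 / 4) := by
  set A := P.normalized with hA
  set a := P.pseudoCompound.normalized *ᵥ intVec w with ha_def
  have ha : a ≠ 0 := fun h => intVec_ne_zero hw
    (Matrix.eq_zero_of_mulVec_eq_zero P.pseudoCompound.det_normalized_ne_zero h)
  have hD0 : 0 ≤ D := (abs_nonneg _).trans (hD 0)
  obtain ⟨f, g, hfg, hdet⟩ := exists_planar_coordinates ha hD
  set N : (Fin 3 → ℤ) → ℝ := fun u => hexNorm (f (A *ᵥ intVec u)) (g (A *ᵥ intVec u))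
  have hcross : ∀ u v : Fin 3 → ℤ, u ⨯₃ v = w → (A *ᵥ intVec u) ⨯₃ (A *ᵥ intVec v) = a := by
    intro u v h
    rw [← adjugate_transpose_mulVec_crossProduct, ← intVec_crossProduct, h, ha_def,
      normalized_pseudoCompound]
  have hbound : ∀ u v : Fin 3 → ℤ, u ⨯₃ v = w → ∀ i, |(A *ᵥ intVec u) i| ≤ N u := by
    intro u v h
    refine hfg _ ?_
    rw [← hcross u v h, dotProduct_comm, dot_self_cross]
  have hne : ∀ u v : Fin 3 → ℤ, u ⨯₃ v = w → u ≠ 0 := by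
    rintro u v h rfl
    exact hw (by rw [← h]; simp)
  have hshort : ∀ m : ℝ, 0 < m → 4 * D < 3 * m ^ 2 →
      ∃ u v : Fin 3 → ℤ, u ⨯₃ v = w ∧ N u < m := by
    intro m hm hDm
    by_contra! hcon
    have hm2 : 0 < m ^ 2 := by positivity
    obtain ⟨u₀, v₀, h₀⟩ := exists_crossProduct_eq w
    -- `q` lies strictly between `1 / 4 + D / m²` (or `1 / 2 + D / (2 m²)`) and `1`
    refine Set.Nonempty.ne_empty (s := {s | ∃ u v : Fin 3 → ℤ, u ⨯₃ v = w ∧ N u = s})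
      ⟨_, u₀, v₀, h₀, rfl⟩
      (eq_empty_of_contracting (m := m) (q := 5 / 8 + D / m ^ 2 / 2) hm (by positivity) ?_ ?_ ?_)
    · have : D / m ^ 2 < 3 / 4 := by rw [div_lt_iff₀ hm2]; linarith
      linarith
    · rintro s ⟨u, v, huv, rfl⟩
      exact hcon u v huv
    · rintro s ⟨u, v, huv, hus⟩
      have hms : m ≤ s := hus ▸ hcon u v huv
      have hs : 0 < s := hm.trans_le hms
      have hκ : D / m ^ 2 < 3 / 4 := by rw [div_lt_iff₀ hm2]; linarith
      have hDs : D ≤ D / m ^ 2 * s ^ 2 := by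
        rw [div_mul_eq_mul_div, le_div_iff₀ hm2]
        gcongr
      set κ := D / m ^ 2
      have hs2 : 0 < s ^ 2 := by positivity
      have hκs : κ * s ^ 2 ≤ 3 / 4 * s ^ 2 := by gcongr
      obtain ⟨v', hv', hr⟩ := exists_reduced_pair (r := (5 / 8 + κ / 2) * s) hs hus
        (hdet _ _ (hcross u v huv)) (by nlinarith) (by nlinarith)
      exact ⟨_, ⟨v', -u, hv'.trans huv, rfl⟩, hr⟩
  refine ⟨fun m hm hDm => ?_, fun hD1 hD2 hlow => ?_⟩
  · obtain ⟨u, v, huv, hu⟩ := hshort m hm hDm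
    exact ⟨u, hne u v huv, fun i => (hbound u v huv i).trans hu.le⟩
  · obtain ⟨u, v, huv, hu⟩ := hshort (5 / 4) (by norm_num) (by norm_num; linarith)
    have hs1 := hlow u (hne u v huv) _ (hbound u v huv)
    set s := N u with hs_def
    obtain ⟨v', hv', hr⟩ := exists_reduced_pair (r := 5 / 4) (s := s) (by linarith) hs_def.symm
      (hdet _ _ (hcross u v huv)) (by nlinarith) (by nlinarith)
    refine ⟨v', -u, by rwa [hv', huv], fun i => (hbound v' _ (hv'.trans huv) i).trans hr,
      fun i => ?_⟩
    have e : intVec (-u) = -intVec u := by ext i; simp [intVec]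
    rw [e, Matrix.mulVec_neg, Pi.neg_apply, abs_neg]
    exact (hbound u v huv i).trans hu.le

theorem mu_one_le_two_div_sqrt_three (P : SymmParallelepiped 3)
    (h : P.pseudoCompound.mu 1 ≤ 1) : P.mu 1 ≤ 2 / √3 := by
  refine le_of_forall_gt_imp_ge_of_dense fun m hm => ?_
  have h3 : 0 < √(3 : ℝ) := by positivity
  have hm0 : 0 < m := lt_trans (by positivity) hm
  have hm2 : 4 < 3 * m ^ 2 := by
    rw [div_lt_iff₀ h3] at hm
    have h4 : √(3 : ℝ) ^ 2 = 3 := Real.sq_sqrt (by norm_num)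
    nlinarith
  -- `D` is the midpoint of `1` and `3 m² / 4`
  obtain ⟨w, hw, hwD⟩ := P.pseudoCompound.exists_of_mu_one_lt
    (D := (1 + 3 * m ^ 2 / 4) / 2) (by linarith)
  obtain ⟨u, hu, hum⟩ := (P.exists_short_pair hw hwD).1 m hm0 (by linarith)
  exact P.mu_one_le hm0 hu hum

theorem mu_two_le_five_div_four (P : SymmParallelepiped 3)
    (h : P.pseudoCompound.mu 1 ≤ 1) (h1 : 1 < P.mu 1) : P.mu 2 ≤ 5 / 4 := by
  have hlow : ∀ u : Fin 3 → ℤ, u ≠ 0 → ∀ r : ℝ,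
      (∀ i, |(P.normalized *ᵥ intVec u) i| ≤ r) → P.mu 1 ≤ r := by
    intro u hu r hr
    by_contra! hlt
    have hpos : 0 < (r + P.mu 1) / 2 := by
      have := (abs_nonneg _).trans (hr 0)
      linarith
    have := P.mu_one_le hpos hu fun i => (hr i).trans (by linarith)
    linarith
  have h2 : P.mu 1 ≤ 5 / 4 := by
    refine (P.mu_one_le_two_div_sqrt_three h).trans ?_
    have h3 : 8 / 5 ≤ √(3 : ℝ) := Real.le_sqrt_of_sq_le (by norm_num)
    rw [div_le_iff₀ (by positivity)]
    linarith
  obtain ⟨w, hw, hwD⟩ := P.pseudoCompound.exists_of_mu_one_lt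
    (D := 1 + (P.mu 1 - 1) / 2) (by linarith)
  obtain ⟨u, v, huv, hu, hv⟩ := (P.exists_short_pair hw hwD).2 (by linarith) (by linarith)
    fun u hu r hr => by linarith [hlow u hu r hr]
  exact P.mu_two_le (by norm_num) huv hu hv

end SymmParallelepiped

end

/-! ### The extremal family -/

section

open scoped Matrix

/-- The matrix whose first two columns span, in the plane `x₀ + x₁ + x₂ = 0`, a lattice of
hexagonal minima `s` and `s / 4 + 1 / s` and of area `1` in each coordinate projection; the third
column `(0, 0, 4)` keeps all other lattice points away from that plane. -/
noncomputable def extremalMatrix (s : ℝ) : Matrix (Fin 3) (Fin 3) ℝ :=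
  !![s, s / 2, 0; -(s / 2), 1 / s - s / 4, 0; -(s / 2), -(1 / s + s / 4), 4]

theorem det_extremalMatrix {s : ℝ} (hs : s ≠ 0) : (extremalMatrix s).det = 4 := by
  rw [extremalMatrix, Matrix.det_fin_three]
  simp
  field_simp
  ring

/-- The three coordinates of `extremalMatrix s *ᵥ z`, in terms of the auxiliary quantity
`z 0 + z 1 / 2`. -/
theorem extremalMatrix_mulVec (s : ℝ) (z : Fin 3 → ℤ) :
    extremalMatrix s *ᵥ intVec z = ![s * (z 0 + z 1 / 2),
      z 1 / s - s / 2 * (z 0 + z 1 / 2),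
      -(z 1 / s) - s / 2 * (z 0 + z 1 / 2) + 4 * z 2] := by
  ext i
  fin_cases i <;> simp [extremalMatrix, Matrix.mulVec, dotProduct, Fin.sum_univ_three, intVec] <;>
    ring

theorem extremalMatrix_cofactor_mulVec {s : ℝ} (hs : s ≠ 0) (z : Fin 3 → ℤ) :
    (extremalMatrix s).adjugateᵀ *ᵥ intVec z = ![4 * (z 0 / s + s / 2 * (z 1 - z 0 / 2)) + z 2,
      4 * (s * (z 1 - z 0 / 2)) + z 2, (z 2 : ℝ)] := by
  ext i
  fin_cases i <;> simp [extremalMatrix, Matrix.mulVec, dotProduct, Fin.sum_univ_three, intVec,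
    Matrix.adjugate_fin_three] <;> field_simp <;> ring

theorem one_le_abs_intCast {n : ℤ} (hn : n ≠ 0) : (1 : ℝ) ≤ |(n : ℝ)| := by
  exact_mod_cast Int.one_le_abs hn

/-- Lattice points outside the plane are far away. -/
theorem four_thirds_le_of_third_ne_zero {s r : ℝ} {z : Fin 3 → ℤ} (hz : z 2 ≠ 0)
    (h : ∀ i, |(extremalMatrix s *ᵥ intVec z) i| ≤ r) : 4 / 3 ≤ r := by
  rw [extremalMatrix_mulVec] at h
  have h0 := h 0
  have h1 := h 1
  have h2 := h 2
  simp only [Matrix.cons_val] at h0 h1 h2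
  -- the coordinates add up to `4 z₂`
  have h3 := one_le_abs_intCast hz
  rw [abs_le] at h0 h1 h2
  rcases le_abs.mp h3 with h3 | h3 <;> linarith

/-- Within the plane, the points outside the line through the first column have norm at least
`s / 4 + 1 / s`. -/
theorem second_minimum_le {s r : ℝ} (hs : 1 ≤ s) (hs2 : s ≤ 2) {z : Fin 3 → ℤ} (hz2 : z 2 = 0)
    (hz1 : z 1 ≠ 0) (h : ∀ i, |(extremalMatrix s *ᵥ intVec z) i| ≤ r) : s / 4 + 1 / s ≤ r := by
  rw [extremalMatrix_mulVec] at h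
  have h1 := h 1
  have h2 := h 2
  simp only [Matrix.cons_val, hz2, Int.cast_zero, mul_zero, add_zero] at h1 h2
  set q : ℝ := z 0 + z 1 / 2 with hq
  have hs0 : 0 < s := by linarith
  have hsum : |(z 1 : ℝ)| * (1 / s) + s / 2 * |q| ≤ r := by
    have e1 : |(z 1 : ℝ)| * (1 / s) = |(z 1 : ℝ) / s| := by
      rw [abs_div, abs_of_pos hs0]; ring
    have e2 : s / 2 * |q| = |s / 2 * q| := by rw [abs_mul, abs_of_pos (half_pos hs0)]
    rw [e1, e2]
    rw [abs_le] at h1 h2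
    rcases abs_choice ((z 1 : ℝ) / s) with h | h <;> rcases abs_choice (s / 2 * q) with h' | h' <;>
      rw [h, h'] <;> linarith
  refine le_trans ?_ hsum
  have hi : 0 < 1 / s := by positivity
  by_cases hone : |z 1| = 1
  · -- `q` is half an odd integer
    have hq' : 1 / 2 ≤ |q| := by
      have e : 2 * q = ((2 * z 0 + z 1 : ℤ) : ℝ) := by rw [hq]; push_cast; ring
      have hodd : 2 * z 0 + z 1 ≠ 0 := by
        intro h
        rcases (abs_eq one_pos.le).mp hone with h' | h' <;> omega
      have := one_le_abs_intCast hodd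
      rw [← e, abs_mul, abs_of_pos (two_pos : (0 : ℝ) < 2)] at this
      linarith
    have hone' : |(z 1 : ℝ)| = 1 := by exact_mod_cast hone
    rw [hone']
    nlinarith
  · have htwo : (2 : ℝ) ≤ |(z 1 : ℝ)| := by
      have := Int.one_le_abs hz1
      have h2 : 2 ≤ |z 1| := by omega
      exact_mod_cast h2
    have h4 : s / 4 ≤ 1 / s := by
      rw [le_div_iff₀ hs0]
      nlinarith
    have h5 : 0 ≤ s / 2 * |q| := by positivity
    nlinarith

theorem first_minimum_le {s r : ℝ} (hs : 1 ≤ s) (hs2 : 3 * s ^ 2 ≤ 4) {z : Fin 3 → ℤ}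
    (hz : z ≠ 0) (h : ∀ i, |(extremalMatrix s *ᵥ intVec z) i| ≤ r) : s ≤ r := by
  have hs43 : s ≤ 4 / 3 := by nlinarith
  have hs0 : 0 < s := by linarith
  by_cases h2 : z 2 = 0
  · by_cases h1 : z 1 = 0
    · have h0 : z 0 ≠ 0 := by
        intro h0
        apply hz
        ext i
        fin_cases i
        · exact h0
        · exact h1
        · exact h2
      have h := h 0
      rw [extremalMatrix_mulVec] at h
      simp only [Matrix.cons_val, h1, Int.cast_zero, zero_div, add_zero] at h
      rw [abs_mul, abs_of_pos hs0] at h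
      have := one_le_abs_intCast h0
      nlinarith
    · refine le_trans ?_ (second_minimum_le hs (by linarith) h2 h1 h)
      have : s * (3 / 4) ≤ 1 / s := by
        rw [le_div_iff₀ hs0]
        linarith
      linarith
  · exact hs43.trans (four_thirds_le_of_third_ne_zero h2 h)

theorem one_le_of_cofactor {s r : ℝ} (hs : 1 ≤ s) (hs2 : s ≤ 4) {z : Fin 3 → ℤ} (hz : z ≠ 0)
    (h : ∀ i, |((extremalMatrix s).adjugateᵀ *ᵥ intVec z) i| ≤ r) : 1 ≤ r := by
  have hs0 : 0 < s := by linarith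
  rw [extremalMatrix_cofactor_mulVec hs0.ne'] at h
  have h0 := h 0
  have h1 := h 1
  have h2 := h 2
  simp only [Matrix.cons_val] at h0 h1 h2
  by_cases hz2 : z 2 = 0
  · rw [hz2, Int.cast_zero, add_zero] at h0 h1
    by_cases hp : 2 * z 1 - z 0 = 0
    · have e : (z 1 : ℝ) - z 0 / 2 = 0 := by
        have : ((2 * z 1 - z 0 : ℤ) : ℝ) = 0 := by exact_mod_cast hp
        push_cast at this
        linarith
      have hz0 : z 0 ≠ 0 := by
        intro h0
        apply hz
        ext i
        fin_cases i
        · exact h0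
        · change z 1 = 0; omega
        · exact hz2
      rw [e, mul_zero, add_zero, abs_mul, abs_div, abs_of_pos hs0,
        abs_of_pos (by norm_num : (0 : ℝ) < 4)] at h0
      have h3 := one_le_abs_intCast hz0
      refine le_trans ?_ h0
      rw [← mul_div_assoc, le_div_iff₀ hs0]
      linarith
    · have h3 := one_le_abs_intCast hp
      have e : (z 1 : ℝ) - z 0 / 2 = ((2 * z 1 - z 0 : ℤ) : ℝ) / 2 := by push_cast; ring
      rw [e, abs_mul, abs_mul, abs_div, abs_of_pos hs0, abs_of_pos (by norm_num : (0 : ℝ) < 4),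
        abs_of_pos (by norm_num : (0 : ℝ) < 2)] at h1
      nlinarith
  · exact (one_le_abs_intCast hz2).trans h2

/-- For every `s ≥ 1` with `3 s² ≤ 4` there is a parallelepiped with first minimum `s` and second
minimum `s / 4 + 1 / s` whose pseudo-compound has first minimum `1`. The end points `s = 1` and
`s = 2 / √3` of the family are the two extremal parallelepipeds. -/
theorem exists_extremal {s : ℝ} (hs : 1 ≤ s) (hs2 : 3 * s ^ 2 ≤ 4) :
    ∃ P : SymmParallelepiped 3,
      P.pseudoCompound.mu 1 = 1 ∧ P.mu 1 = s ∧ P.mu 2 = s / 4 + 1 / s := by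
  have hs0 : 0 < s := by linarith
  have hs43 : s ≤ 4 / 3 := by nlinarith
  have hi0 : 0 < 1 / s := by positivity
  have hi : s * (3 / 4) ≤ 1 / s := by
    rw [le_div_iff₀ hs0]
    linarith
  have hi1 : 1 / s ≤ 1 := by
    rw [div_le_iff₀ hs0]
    linarith
  have hle : s / 4 + 1 / s ≤ 4 / 3 := by
    have : s / 4 + 1 / s ≤ 5 / 4 := by
      rw [← le_sub_iff_add_le', div_le_iff₀ hs0]
      nlinarith
    linarith
  obtain ⟨P, hP⟩ := SymmParallelepiped.exists_normalized_eq (extremalMatrix s)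
    (by rw [det_extremalMatrix hs0.ne']; norm_num)
  have hu : ∀ i, |(P.normalized *ᵥ intVec ![1, 0, 0]) i| ≤ s := by
    rw [hP, extremalMatrix_mulVec]
    intro i
    rw [abs_le]
    fin_cases i <;> constructor <;> simp <;> linarith
  have hv : ∀ i, |(P.normalized *ᵥ intVec ![0, 1, 0]) i| ≤ s / 4 + 1 / s := by
    rw [hP, extremalMatrix_mulVec]
    rw [one_div] at *
    intro i
    rw [abs_le]
    fin_cases i <;> constructor <;> simp <;> linarith
  refine ⟨P, ?_, ?_, ?_⟩
  · refine P.pseudoCompound.mu_one_eq one_pos (z := ![0, 0, 1]) (fun h => ?_) ?_ ?_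
    · simpa using congrFun h 2
    · rw [P.normalized_pseudoCompound, hP, extremalMatrix_cofactor_mulVec hs0.ne']
      intro i
      fin_cases i <;> simp
    · intro w hw μ hμ
      rw [P.normalized_pseudoCompound, hP] at hμ
      exact one_le_of_cofactor hs (by linarith) hw hμ
  · refine P.mu_one_eq hs0 (z := ![1, 0, 0]) (fun h => ?_) hu ?_
    · simpa using congrFun h 0
    · intro w hw μ hμ
      rw [hP] at hμ
      exact first_minimum_le hs hs2 hw hμ
  · refine P.mu_two_eq (by positivity) (u := ![1, 0, 0]) (v := ![0, 1, 0]) (fun h => ?_)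
      (fun i => (hu i).trans (by linarith)) hv ?_
    · simpa [cross_apply] using congrFun h 2
    · intro u v huv μ hμu hμv
      rw [hP] at hμu hμv
      -- being independent, `u` and `v` do not both lie on the line through the first column
      by_cases hu2 : u 2 = 0
      · by_cases hv2 : v 2 = 0
        · by_cases hu1 : u 1 = 0
          · by_cases hv1 : v 1 = 0
            · exfalso
              apply huv
              ext i
              fin_cases i <;> simp [cross_apply, hu1, hu2, hv1, hv2]
            · exact second_minimum_le hs (by linarith) hv2 hv1 hμv
          · exact second_minimum_le hs (by linarith) hu2 hu1 hμu
        · exact hle.trans (four_thirds_le_of_third_ne_zero hv2 hμv)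
      · exact hle.trans (four_thirds_le_of_third_ne_zero hu2 hμu)

end

theorem theorem3 :
    -- the two inequalities
    (∀ P : SymmParallelepiped 3, P.pseudoCompound.mu 1 ≤ 1 → 1 < P.mu 1 →
      P.mu 1 ≤ 2 / Real.sqrt 3 ∧ P.mu 2 ≤ 5 / 4) ∧
    -- neither constant can be replaced by a smaller one
    (∀ c : ℝ, (∀ P : SymmParallelepiped 3, P.pseudoCompound.mu 1 ≤ 1 → 1 < P.mu 1 →
      P.mu 1 ≤ c) → 2 / Real.sqrt 3 ≤ c) ∧
    (∀ c : ℝ, (∀ P : SymmParallelepiped 3, P.pseudoCompound.mu 1 ≤ 1 → 1 < P.mu 1 →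
      P.mu 2 ≤ c) → 5 / 4 ≤ c) ∧
    -- the extremal examples; in the second one the first minimum equals 1
    (∃ P : SymmParallelepiped 3, P.pseudoCompound.mu 1 = 1 ∧ P.mu 1 = 2 / Real.sqrt 3) ∧
    (∃ P : SymmParallelepiped 3, P.pseudoCompound.mu 1 = 1 ∧ P.mu 1 = 1 ∧ P.mu 2 = 5 / 4) := by
  have h3 : 0 < √(3 : ℝ) := by positivity
  have h4 : √(3 : ℝ) ^ 2 = 3 := Real.sq_sqrt (by norm_num)
  have hgt : 1 < 2 / √(3 : ℝ) := by
    rw [lt_div_iff₀ h3]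
    nlinarith
  have hsq : 3 * (2 / √(3 : ℝ)) ^ 2 ≤ 4 := by
    rw [div_pow, h4]
    norm_num
  refine ⟨fun P h h1 => ⟨P.mu_one_le_two_div_sqrt_three h, P.mu_two_le_five_div_four h h1⟩,
    fun c hc => ?_, fun c hc => ?_, ?_, ?_⟩
  · obtain ⟨P, hP1, hP2, -⟩ := exists_extremal hgt.le hsq
    rw [← hP2]
    exact hc P hP1.le (by rwa [hP2])
  · -- the second minimum `s / 4 + 1 / s` tends to `5 / 4` as `s ↓ 1`
    have hlim : Filter.Tendsto (fun s : ℝ => s / 4 + 1 / s) (nhdsWithin 1 (Set.Ioi 1))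
        (nhds (5 / 4)) := by
      have hcont : ContinuousAt (fun s : ℝ => s / 4 + 1 / s) 1 := by
        fun_prop (disch := norm_num)
      have := hcont.tendsto
      norm_num at this
      norm_num
      exact this.mono_left nhdsWithin_le_nhds
    refine le_of_tendsto hlim ?_
    filter_upwards [Ioo_mem_nhdsGT hgt] with s hs
    have hs0 : 0 ≤ s := zero_le_one.trans hs.1.le
    have hs2 : 3 * s ^ 2 ≤ 3 * (2 / √3) ^ 2 := by
      gcongr
      exact hs.2.le
    obtain ⟨P, hP1, hP2, hP3⟩ := exists_extremal hs.1.le (hs2.trans hsq)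
    rw [← hP3]
    exact hc P hP1.le (by rw [hP2]; exact hs.1)
  · obtain ⟨P, hP1, hP2, -⟩ := exists_extremal hgt.le hsq
    exact ⟨P, hP1, hP2⟩
  · obtain ⟨P, hP1, hP2, hP3⟩ := exists_extremal le_rfl (by norm_num)
    exact ⟨P, hP1, hP2, by rw [hP3]; norm_num⟩
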